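/- Let $G=(V,E)$ be a finite, simple, connected, undirected graph with symmetric weights $\omega_{ij}>0$ for $ij\in E$, $\omega_{ij}=0$ otherwise. Let $r\in[0,1]$ and $\varepsilon>0$, and put $d_i:=\sum_j\omega_{ij}$ (if $|V|=1$, assume $r=0$ and read $0^0=1$). For $u,v:V\to\mathbb R$ write $\langle u,v\rangle:=\sum_{i}u_iv_id_i^r$, $\|u\|^2:=\langle u,u\rangle$, $\bar u:=\langle u,\mathbf 1\rangle/\langle\mathbf 1,\mathbf 1\rangle$, and $(\Delta u)_i:=d_i^{-r}\sum_j\omega_{ij}(u_i-u_j)$. The Ginzburg–Landau energy with the double-obstacle potential is $$\mathrm{GL}(u):=\tfrac14\sum_{i,j\in V}\omega_{ij}(u_j-u_i)^2+\tfrac1\varepsilon\sum_{i\in V}d_i^r\,W(u_i),\qquad W(x):=\begin{cases}\tfrac12x(1-x),&0\le x\le1,\\ \infty,&\text{otherwise.}\end{cases}$$ For $u:V\to[0,1]$ let $\mathcal B(u)$ be the set of all $\beta:V\to\mathbb R$ such that, for every $i$, $\beta_i\ge0$ if $u_i=0$, $\beta_i=0$ if $0<u_i<1$, and $\beta_i\le0$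 if $u_i=1$; let $\mathcal B(u):=\emptyset$ for all other $u:V\to\mathbb R$. Fix $u_0:V\to[0,1]$. For a time step $\tau\in(0,\varepsilon)$ and $\lambda:=\tau/\varepsilon$, the mass-conserving semi-discrete scheme with initial state $u_0$ is $$u_{m+1}-e^{-\tau\Delta}u_m-\lambda u_{m+1}+\lambda\overline{u_{m+1}}\mathbf 1=\lambda\beta_{m+1}-\lambda\overline{\beta_{m+1}}\mathbf 1,\qquad \beta_{m+1}\in\mathcal B(u_{m+1}),\qquad m\ge0,$$ and its iterates are denoted $u^{[\tau]}_m$. For time steps $\tau_n\in(0,\varepsilon)$ with $\tau_n\to0$, a function $\hat u$ from $[0,\infty)$ to the functions $V\to\mathbb R$ is called the semi-discrete limit along $(\tau_n)$ if $$\hat u(t)=\lim_{n\to\infty}u^{[\tau_n]}_{\lceil t/\tau_n\rceil}\qquad\text{for all }t\ge0.$$ (i) Every sequence of positive time steps tending to $0$ has a subsequence lying in $(0,\varepsilon)$ along which a semi-discrete limit $\hat u$ exists. (ii) For every semi-discrete limit $\hat u$, the energy $\mathrm{GL}(\hat u(t))$ is non-increasing in $t\in[0,\infty)$, and for all $t>s\ge0$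 $$\mathrm{GL}(\hat u(s))-\mathrm{GL}(\hat u(t))\ \ge\ \frac{1}{2(t-s)}\,\|\hat u(s)-\hat u(t)\|^2 .$$ -/

import Mathlib

open Filter Topology Set

/-- A finite (the vertex type will be a `Fintype`), simple, connected, undirected graph with
positive edge weights, the weights being extended by `0` to pairs that are not edges. -/
structure WeightedGraph (V : Type*) where
  graph : SimpleGraph V
  connected : graph.Connected
  weight : V → V → ℝ
  weight_symm : ∀ i j, weight i j = weight j i
  weight_pos : ∀ i j, graph.Adj i j → 0 < weight i j
  weight_zero : ∀ i j, ¬ graph.Adj i j → weight i j = 0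

namespace WeightedGraph

noncomputable section

variable {V : Type*} [Fintype V] (G : WeightedGraph V)

/-- The degree `d_i = ∑_j ω_ij`. -/
def degree (i : V) : ℝ := ∑ j, G.weight i j

/-- The inner product `⟨u, v⟩ = ∑_i u_i v_i d_i ^ r` on vertex functions. -/
def ip (r : ℝ) (u v : V → ℝ) : ℝ := ∑ i, u i * v i * G.degree i ^ r

/-- The norm `‖u‖ = ⟨u, u⟩ ^ (1/2)` on vertex functions. -/
def vnorm (r : ℝ) (u : V → ℝ) : ℝ := Real.sqrt (G.ip r u u)

/-- The average value `⟨u, 1⟩ / ⟨1, 1⟩`. -/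
def avg (r : ℝ) (u : V → ℝ) : ℝ := G.ip r u 1 / G.ip r 1 1

/-- The inner product `½ ∑_{i,j} φ_ij ψ_ij ω_ij` on edge functions. -/
def edgeIp (φ ψ : V → V → ℝ) : ℝ := (1 / 2) * ∑ i, ∑ j, φ i j * ψ i j * G.weight i j

/-- The norm on edge functions. -/
def edgeNorm (φ : V → V → ℝ) : ℝ := Real.sqrt (G.edgeIp φ φ)

open Classical in
/-- The graph gradient. -/
def grad (u : V → ℝ) (i j : V) : ℝ := if G.graph.Adj i j then u j - u i else 0

/-- The graph Laplacian `(Δ u)_i = d_i ^ (-r) ∑_j ω_ij (u_i - u_j)`. -/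
def laplacian (r : ℝ) : (V → ℝ) →ₗ[ℝ] (V → ℝ) where
  toFun u i := G.degree i ^ (-r) * ∑ j, G.weight i j * (u i - u j)
  map_add' u v := by
    funext i
    simp only [Pi.add_apply, ← mul_add, ← Finset.sum_add_distrib]
    congr 1
    exact Finset.sum_congr rfl fun j _ => by ring
  map_smul' c u := by
    funext i
    simp only [Pi.smul_apply, smul_eq_mul, RingHom.id_apply, Finset.mul_sum]
    exact Finset.sum_congr rfl fun j _ => by ring

/-- The graph diffusion operator `e ^ (-tΔ) = ∑_n (-t) ^ n / n! Δ ^ n`. -/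
def diffusion (r t : ℝ) (u : V → ℝ) : V → ℝ :=
  NormedSpace.exp ((-t) • LinearMap.toContinuousLinearMap (G.laplacian r)) u

end

end WeightedGraph

noncomputable section

open Classical in
/-- The double-obstacle potential: `x (1 - x) / 2` on `[0, 1]`, and `∞` elsewhere. -/
def doubleObstacle (x : ℝ) : EReal :=
  if 0 ≤ x ∧ x ≤ 1 then ((1 / 2 * x * (1 - x) : ℝ) : EReal) else ⊤

/-- The set `𝓑(u)` of `β` with `β_i ∈ -∂I_{[0,1]}(u_i)` for all `i`: it is empty unless all
`u_i` lie in `[0, 1]`, and then `β_i` lies in `[0, ∞)`, `{0}`, `(-∞, 0]` according to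
`u_i = 0`, `0 < u_i < 1`, `u_i = 1`. -/
def negSubdiff {V : Type*} (u : V → ℝ) : Set (V → ℝ) :=
  {β | ∀ i, u i ∈ Icc (0 : ℝ) 1 ∧ (u i = 0 → 0 ≤ β i) ∧ (u i ∈ Ioo (0 : ℝ) 1 → β i = 0) ∧
    (u i = 1 → β i ≤ 0)}

namespace WeightedGraph

variable {V : Type*} [Fintype V] (G : WeightedGraph V)

/-- The Ginzburg-Landau energy `½ ‖∇u‖² + (1/ε) ⟨W ∘ u, 1⟩` with the double-obstacle potential
`W`; its values lie in `[0, ∞]`. -/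
def ginzburgLandau (r ε : ℝ) (u : V → ℝ) : EReal :=
  ((1 / 2 * G.edgeNorm (G.grad u) ^ 2 : ℝ) : EReal) +
    ((1 / ε : ℝ) : EReal) * ∑ i, doubleObstacle (u i) * ((G.degree i ^ r : ℝ) : EReal)

/-- `(u, β)` is a trajectory of the mass-conserving semi-discrete scheme with time step `τ`
(so `lam = τ / ε`) and initial state `u₀`. The entry `β 0` plays no role. -/
def IsSemiDiscrete (r ε τ : ℝ) (u₀ : V → ℝ) (u β : ℕ → V → ℝ) : Prop :=
  u 0 = u₀ ∧ ∀ m, β (m + 1) ∈ negSubdiff (u (m + 1)) ∧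
    let lam := τ / ε
    u (m + 1) - G.diffusion r τ (u m) - lam • u (m + 1)
        + (lam * G.avg r (u (m + 1))) • (1 : V → ℝ)
      = lam • β (m + 1) - (lam * G.avg r (β (m + 1))) • (1 : V → ℝ)

/-- `û` is, on `[0, ∞)`, the limit of the semi-discrete iterates started at `u₀` along the
time steps `τ n ∈ (0, ε)`, `τ n → 0`: for each `t ≥ 0`, the iterate number `⌈t / τ n⌉` of the
scheme with time step `τ n` tends to `û t` as `n → ∞`. -/
def IsSemiDiscreteLimit (r ε : ℝ) (u₀ : V → ℝ) (τ : ℕ → ℝ) (û : ℝ → V → ℝ) : Prop :=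
  (∀ n, 0 < τ n ∧ τ n < ε) ∧ Tendsto τ atTop (𝓝 0) ∧
    ∃ u β : ℕ → ℕ → V → ℝ, (∀ n, G.IsSemiDiscrete r ε (τ n) u₀ (u n) (β n)) ∧
      ∀ t : ℝ, 0 ≤ t → Tendsto (fun n => u n ⌈t / τ n⌉₊) atTop (𝓝 (û t))

end WeightedGraph

end

namespace WeightedGraph

variable {V : Type*} (G : WeightedGraph V)

/-! The scheme is a minimising movement for `discreteEnergy`, in which `(1 - e^(-τΔ)) / τ` replaces
`Δ` in the Ginzburg–Landau energy. Testing one step against `u_{m+1} - u_m` removes the averages,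
because mass is conserved; the multiplier term has a sign, and `e^(-τΔ)` is positive semidefinite.
Hence `(1 - λ)‖u_{m+1} - u_m‖² ≤ 2τ (J(u_m) - J(u_{m+1}))` for `J` the discrete energy
(`discreteEnergy_step`).

Summing and applying Cauchy–Schwarz over `k - m` steps gives `(1 - λ)‖u_k - u_m‖² ≤ 2(k - m)τ
(J(u_m) - J(u_k))` (`IsSemiDiscrete.ip_self_sub_le`). This estimate is used twice. With `J` bounded
uniformly in `τ`, it is a 1/2-Hölder bound up to an error of order `τ`, and compactness yields (i).
As `τ → 0`, `(1 - e^(-τΔ)) / τ → Δ` and `λ → 0`, so it becomes exactly the inequality in (ii), and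
monotonicity follows. -/

theorem weight_nonneg (i j : V) : 0 ≤ G.weight i j := by
  by_cases h : G.graph.Adj i j
  · exact (G.weight_pos i j h).le
  · exact (G.weight_zero i j h).ge

variable [Fintype V]

theorem degree_nonneg (i : V) : 0 ≤ G.degree i :=
  Finset.sum_nonneg fun j _ => G.weight_nonneg i j

theorem degree_pos [Nontrivial V] (i : V) : 0 < G.degree i := by
  obtain ⟨j, hj⟩ := G.connected.preconnected.exists_adj_of_nontrivial i
  exact Finset.sum_pos' (fun j _ => G.weight_nonneg i j) ⟨j, Finset.mem_univ j, G.weight_pos i j hj⟩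

/-- On a single vertex the degree is `0`, and the convention `0 ^ 0 = 1` keeps the inner product
definite. -/
theorem degree_rpow_pos {r : ℝ} (hV : Nontrivial V ∨ r = 0) (i : V) : 0 < G.degree i ^ r := by
  rcases hV with h | rfl
  · exact Real.rpow_pos_of_pos (G.degree_pos i) r
  · simp

theorem degree_rpow_mul_rpow_neg {r : ℝ} (hV : Nontrivial V ∨ r = 0) (i : V) :
    G.degree i ^ r * G.degree i ^ (-r) = 1 := by
  rw [Real.rpow_neg (G.degree_nonneg i)]
  exact mul_inv_cancel₀ (G.degree_rpow_pos hV i).ne'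

/-! ### The weighted inner product and averages. -/

section InnerProduct

variable (r : ℝ)

theorem ip_comm (u v : V → ℝ) : G.ip r u v = G.ip r v u := by
  simp only [ip, mul_comm]

theorem ip_add_left (u v w : V → ℝ) : G.ip r (u + v) w = G.ip r u w + G.ip r v w := by
  simp only [ip, Pi.add_apply, add_mul, Finset.sum_add_distrib]

theorem ip_sub_left (u v w : V → ℝ) : G.ip r (u - v) w = G.ip r u w - G.ip r v w := by
  simp only [ip, Pi.sub_apply, sub_mul, Finset.sum_sub_distrib]

theorem ip_smul_left (c : ℝ) (u v : V → ℝ) : G.ip r (c • u) v = c * G.ip r u v := by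
  simp only [ip, Pi.smul_apply, smul_eq_mul, mul_assoc, Finset.mul_sum]

theorem ip_add_right (u v w : V → ℝ) : G.ip r u (v + w) = G.ip r u v + G.ip r u w := by
  rw [ip_comm, ip_add_left, ip_comm, G.ip_comm r w]

theorem ip_sub_right (u v w : V → ℝ) : G.ip r u (v - w) = G.ip r u v - G.ip r u w := by
  rw [ip_comm, ip_sub_left, ip_comm, G.ip_comm r w]

theorem ip_smul_right (c : ℝ) (u v : V → ℝ) : G.ip r u (c • v) = c * G.ip r u v := by
  rw [ip_comm, ip_smul_left, ip_comm]

theorem continuous_ip : Continuous fun p : (V → ℝ) × (V → ℝ) => G.ip r p.1 p.2 := by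
  unfold ip
  fun_prop

theorem ip_self_nonneg (u : V → ℝ) : 0 ≤ G.ip r u u :=
  Finset.sum_nonneg fun i _ => mul_nonneg (mul_self_nonneg _)
    (Real.rpow_nonneg (G.degree_nonneg i) r)

theorem vnorm_sq (u : V → ℝ) : G.vnorm r u ^ 2 = G.ip r u u :=
  Real.sq_sqrt (G.ip_self_nonneg r u)

theorem sq_mul_le_ip_self (u : V → ℝ) (i : V) : u i ^ 2 * G.degree i ^ r ≤ G.ip r u u := by
  rw [sq]
  exact Finset.single_le_sum (f := fun i => u i * u i * G.degree i ^ r)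
    (fun i _ => mul_nonneg (mul_self_nonneg _) (Real.rpow_nonneg (G.degree_nonneg i) r))
    (Finset.mem_univ i)

/-- The Cauchy–Schwarz inequality for a telescoping sum. -/
theorem ip_self_sub_le (u : ℕ → V → ℝ) (m k : ℕ) :
    G.ip r (u (m + k) - u m) (u (m + k) - u m) ≤
      k * ∑ j ∈ Finset.range k,
        G.ip r (u (m + j + 1) - u (m + j)) (u (m + j + 1) - u (m + j)) := by
  unfold ip
  rw [Finset.sum_comm, Finset.mul_sum]
  refine Finset.sum_le_sum fun i _ => ?_
  rw [← Finset.sum_mul, ← mul_assoc]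
  refine mul_le_mul_of_nonneg_right ?_ (Real.rpow_nonneg (G.degree_nonneg i) r)
  have h := sq_sum_le_card_mul_sum_sq (s := Finset.range k)
    (f := fun j => u (m + j + 1) i - u (m + j) i)
  have h2 := Finset.sum_range_sub (fun j => u (m + j) i) k
  simp only [← add_assoc, add_zero] at h2
  rw [h2, Finset.card_range] at h
  simpa [sq] using h

theorem ip_one_one_pos {r : ℝ} (hV : Nontrivial V ∨ r = 0) : 0 < G.ip r 1 1 := by
  have := G.connected.nonempty
  unfold ip
  refine Finset.sum_pos (fun i _ => ?_) Finset.univ_nonempty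
  simpa using G.degree_rpow_pos hV i

theorem avg_mul_ip_one_one {r : ℝ} (hV : Nontrivial V ∨ r = 0) (u : V → ℝ) :
    G.avg r u * G.ip r 1 1 = G.ip r u 1 :=
  div_mul_cancel₀ _ (G.ip_one_one_pos hV).ne'

theorem avg_mem_Icc {r : ℝ} (hV : Nontrivial V ∨ r = 0) {u : V → ℝ}
    (hu : ∀ i, u i ∈ Icc (0 : ℝ) 1) : G.avg r u ∈ Icc (0 : ℝ) 1 := by
  have h1 := G.ip_one_one_pos hV
  refine ⟨div_nonneg (Finset.sum_nonneg fun i _ => ?_) h1.le, (div_le_one h1).2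
    (Finset.sum_le_sum fun i _ => ?_)⟩
  · simpa using mul_nonneg (hu i).1 (G.degree_rpow_pos hV i).le
  · simpa using mul_le_mul_of_nonneg_right (hu i).2 (G.degree_rpow_pos hV i).le

end InnerProduct

/-! ### The Laplacian and its Dirichlet form. -/

section Laplacian

/-- The graph Dirichlet form. -/
theorem ip_laplacian {r : ℝ} (hV : Nontrivial V ∨ r = 0) (u v : V → ℝ) :
    G.ip r (G.laplacian r u) v =
      1 / 2 * ∑ i, ∑ j, G.weight i j * ((u i - u j) * (v i - v j)) := by
  have h : G.ip r (G.laplacian r u) v = ∑ i, ∑ j, G.weight i j * ((u i - u j) * v i) := by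
    refine Finset.sum_congr rfl fun i _ => ?_
    have hi := G.degree_rpow_mul_rpow_neg hV i
    calc _ = (G.degree i ^ r * G.degree i ^ (-r)) *
          ((∑ j, G.weight i j * (u i - u j)) * v i) := by
          simp only [laplacian, LinearMap.coe_mk, AddHom.coe_mk]
          ring
      _ = _ := by
          rw [hi, one_mul, Finset.sum_mul]
          exact Finset.sum_congr rfl fun j _ => by ring
  -- Swapping `i` and `j` and averaging with `h` symmetrises the sum.
  have h' : G.ip r (G.laplacian r u) v = ∑ i, ∑ j, G.weight i j * ((u j - u i) * v j) := by
    rw [h, Finset.sum_comm]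
    exact Finset.sum_congr rfl fun i _ => Finset.sum_congr rfl fun j _ => by
      rw [G.weight_symm]
  have h2 : ∑ i, ∑ j, G.weight i j * ((u i - u j) * (v i - v j)) =
      G.ip r (G.laplacian r u) v + G.ip r (G.laplacian r u) v := by
    nth_rw 1 [h]
    rw [h', ← Finset.sum_add_distrib]
    refine Finset.sum_congr rfl fun i _ => ?_
    rw [← Finset.sum_add_distrib]
    exact Finset.sum_congr rfl fun j _ => by ring
  rw [h2]
  ring

theorem ip_laplacian_comm {r : ℝ} (hV : Nontrivial V ∨ r = 0) (u v : V → ℝ) :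
    G.ip r (G.laplacian r u) v = G.ip r u (G.laplacian r v) := by
  rw [G.ip_comm r u, G.ip_laplacian hV, G.ip_laplacian hV]
  simp only [mul_comm]

theorem laplacian_one (r : ℝ) : G.laplacian r 1 = 0 := by
  ext i
  simp [laplacian]

theorem edgeNorm_grad_sq {r : ℝ} (hV : Nontrivial V ∨ r = 0) (u : V → ℝ) :
    G.edgeNorm (G.grad u) ^ 2 = G.ip r u (G.laplacian r u) := by
  have h : G.edgeIp (G.grad u) (G.grad u) = G.ip r u (G.laplacian r u) := by
    rw [G.ip_comm, G.ip_laplacian hV, edgeIp]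
    congr 1
    refine Finset.sum_congr rfl fun i _ => Finset.sum_congr rfl fun j _ => ?_
    by_cases hij : G.graph.Adj i j
    · simp only [grad, hij, if_true]
      ring
    · simp [grad, hij, G.weight_zero i j hij]
  rw [edgeNorm, Real.sq_sqrt, h]
  refine mul_nonneg (by norm_num) (Finset.sum_nonneg fun i _ => Finset.sum_nonneg fun j _ => ?_)
  exact mul_nonneg (mul_self_nonneg _) (G.weight_nonneg i j)

end Laplacian

/-! ### The heat semigroup. -/

section Heat

/-- The graph diffusion operator as a continuous linear map. -/
noncomputable def heat (r t : ℝ) : (V → ℝ) →L[ℝ] (V → ℝ) :=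
  NormedSpace.exp ((-t) • LinearMap.toContinuousLinearMap (G.laplacian r))

theorem diffusion_eq_heat (r t : ℝ) (u : V → ℝ) : G.diffusion r t u = G.heat r t u := rfl

theorem heat_hasSum (r t : ℝ) (u : V → ℝ) :
    HasSum (fun n : ℕ => ((n.factorial : ℝ)⁻¹ •
      ((-t) • LinearMap.toContinuousLinearMap (G.laplacian r)) ^ n) u) (G.heat r t u) :=
  (NormedSpace.exp_series_hasSum_exp' (𝕂 := ℝ)
    ((-t) • LinearMap.toContinuousLinearMap (G.laplacian r))).mapL
      (ContinuousLinearMap.apply ℝ (V → ℝ) u)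

/-- Constants are killed by the Laplacian, so only the zeroth term of the exponential series
survives. With self-adjointness this gives mass conservation. -/
theorem heat_one (r t : ℝ) : G.heat r t 1 = 1 := by
  refine (G.heat_hasSum r t 1).unique ?_
  convert! hasSum_single (f := fun n : ℕ => ((n.factorial : ℝ)⁻¹ •
      ((-t) • LinearMap.toContinuousLinearMap (G.laplacian r)) ^ n) (1 : V → ℝ)) 0 ?_ using 1
  · simp
  · intro n hn
    obtain ⟨k, rfl⟩ := Nat.exists_eq_succ_of_ne_zero hn
    have h : ((-t) • LinearMap.toContinuousLinearMap (G.laplacian r)) (1 : V → ℝ) = 0 := by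
      simp [laplacian_one]
    rw [smul_apply, Nat.succ_eq_add_one, pow_succ, mul_apply_eq_comp, h, map_zero, smul_zero]

theorem ip_heat_comm {r : ℝ} (hV : Nontrivial V ∨ r = 0) (t : ℝ) (u v : V → ℝ) :
    G.ip r (G.heat r t u) v = G.ip r u (G.heat r t v) := by
  have hpow (n : ℕ) : ∀ u v : V → ℝ,
      G.ip r ((((-t) • LinearMap.toContinuousLinearMap (G.laplacian r)) ^ n) u) v =
        G.ip r u ((((-t) • LinearMap.toContinuousLinearMap (G.laplacian r)) ^ n) v) := by
    induction n with
    | zero => simp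
    | succ n ih =>
      intro u v
      rw [pow_succ, mul_apply_eq_comp, ih, ← pow_succ, pow_succ', mul_apply_eq_comp,
        smul_apply, smul_apply, ip_smul_left, ip_smul_right, LinearMap.coe_toContinuousLinearMap',
        G.ip_laplacian_comm hV]
  have hl : Continuous fun w : V → ℝ => G.ip r w v :=
    (G.continuous_ip r).comp (continuous_id.prodMk continuous_const)
  have hr : Continuous fun w : V → ℝ => G.ip r u w :=
    (G.continuous_ip r).comp (continuous_const.prodMk continuous_id)
  have h1 := (G.heat_hasSum r t u).map
    (AddMonoidHom.mk' (fun w => G.ip r w v) fun a b => G.ip_add_left r a b v) hl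
  have h2 := (G.heat_hasSum r t v).map
    (AddMonoidHom.mk' (fun w => G.ip r u w) fun a b => G.ip_add_right r u a b) hr
  refine h1.unique ?_
  convert! h2 using 1
  funext n
  simp only [Function.comp, AddMonoidHom.mk'_apply, smul_apply, ip_smul_left,
    ip_smul_right, hpow]

/-- The operator is the square of the self-adjoint operator `e^(-(t/2)Δ)`; no spectral decomposition
is needed. -/
theorem ip_heat_nonneg {r : ℝ} (hV : Nontrivial V ∨ r = 0) (t : ℝ) (u : V → ℝ) :
    0 ≤ G.ip r u (G.heat r t u) := by
  have h : G.heat r t = G.heat r (t / 2) * G.heat r (t / 2) := by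
    let _ : NormedAlgebra ℚ ((V → ℝ) →L[ℝ] (V → ℝ)) := NormedAlgebra.restrictScalars ℚ ℝ _
    simp only [heat]
    rw [← NormedSpace.exp_add_of_commute (Commute.refl _), ← add_smul]
    congr 2
    ring
  rw [h, mul_apply_eq_comp, ← G.ip_heat_comm hV]
  exact G.ip_self_nonneg r _

theorem ip_heat_one {r : ℝ} (hV : Nontrivial V ∨ r = 0) (t : ℝ) (u : V → ℝ) :
    G.ip r (G.heat r t u) 1 = G.ip r u 1 := by
  rw [G.ip_heat_comm hV, heat_one]

/-- This is the derivative of the operator exponential at time `0`, in operator norm. It links the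
discrete energy to the Ginzburg–Landau energy. -/
theorem tendsto_inv_smul_one_sub_heat (r : ℝ) {τ : ℕ → ℝ} (hpos : ∀ n, 0 < τ n)
    (hτ : Tendsto τ atTop (𝓝 0)) :
    Tendsto (fun n => (τ n)⁻¹ • (1 - G.heat r (τ n))) atTop
      (𝓝 (LinearMap.toContinuousLinearMap (G.laplacian r))) := by
  have h := hasDerivAt_exp_smul_const (𝕂 := ℝ)
    (-LinearMap.toContinuousLinearMap (G.laplacian r)) (0 : ℝ)
  rw [hasDerivAt_iff_tendsto_slope_zero] at h
  have h2 := (h.comp (tendsto_nhdsWithin_iff.2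
    ⟨hτ, Eventually.of_forall fun n => (hpos n).ne'⟩)).neg
  have e (n : ℕ) : G.heat r (τ n) =
      NormedSpace.exp (τ n • -LinearMap.toContinuousLinearMap (G.laplacian r)) := by
    rw [heat]
    congr 1
    ext
    simp
  simpa [e, Function.comp_def, ← smul_neg] using h2

end Heat

end WeightedGraph

/-- The subgradient inequality for the indicator of `[0, 1]`: at an active bound, `β i` points into
the interval. -/
theorem sub_mul_nonpos_of_mem_negSubdiff {V : Type*} {a b β : V → ℝ} (ha : ∀ i, a i ∈ Icc (0 : ℝ) 1)
    (hβ : β ∈ negSubdiff b) (i : V) : (b i - a i) * β i ≤ 0 := by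
  obtain ⟨hb, h0, hm, h1⟩ := hβ i
  rcases hb.1.eq_or_lt with h | h
  · exact mul_nonpos_of_nonpos_of_nonneg (by linarith [(ha i).1]) (h0 h.symm)
  rcases hb.2.eq_or_lt with h' | h'
  · exact mul_nonpos_of_nonneg_of_nonpos (by linarith [(ha i).2]) (h1 h')
  · simp [hm ⟨h, h'⟩]

/-! ### Solvability of the scheme. -/

namespace WeightedGraph

variable {V : Type*} [Fintype V] (G : WeightedGraph V)

/-- Every state with values in `[0, 1]` has a successor in the semi-discrete scheme: it is the
diffused state, shifted by a constant that restores the mass, rescaled and truncated. -/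
theorem exists_semiDiscrete_step {r : ℝ} (hV : Nontrivial V ∨ r = 0) (τ : ℝ) {lam : ℝ}
    (h0 : 0 < lam) (h1 : lam < 1) {a : V → ℝ} (ha : ∀ i, a i ∈ Icc (0 : ℝ) 1) :
    ∃ b β : V → ℝ, (∀ i, b i ∈ Icc (0 : ℝ) 1) ∧ β ∈ negSubdiff b ∧
      b - G.diffusion r τ a - lam • b + (lam * G.avg r b) • (1 : V → ℝ)
        = lam • β - (lam * G.avg r β) • (1 : V → ℝ) := by
  have hl : 0 < 1 - lam := by linarith
  have hK := G.ip_one_one_pos hV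
  set S := G.heat r τ a with hS
  let clip : ℝ → V → ℝ := fun c i => max 0 (min 1 ((S i + c) / (1 - lam)))
  have hclip (c : ℝ) (i : V) : clip c i ∈ Icc (0 : ℝ) 1 := by
    refine ⟨le_max_left _ _, max_le zero_le_one (min_le_left _ _)⟩
  have hcont : Continuous fun c => G.avg r (clip c) := by
    simp only [avg, ip, clip]
    fun_prop
  have hbound (i : V) : |S i| ≤ ‖S‖ := norm_le_pi_norm S i
  have hlow : clip (-‖S‖) = 0 := by
    funext i
    have : (S i + -‖S‖) / (1 - lam) ≤ 0 :=
      div_nonpos_of_nonpos_of_nonneg (by linarith [le_abs_self (S i), hbound i]) hl.le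
    exact max_eq_left ((min_le_right _ _).trans this)
  have hhigh : clip (‖S‖ + 1) = 1 := by
    funext i
    have : 1 ≤ (S i + (‖S‖ + 1)) / (1 - lam) := by
      rw [le_div_iff₀ hl]
      linarith [neg_abs_le (S i), hbound i]
    simp only [clip, min_eq_left this, Pi.one_apply]
    norm_num
  -- The average of `clip c` is continuous in `c` and runs from `0` to `1`, so some shift restores
  -- the mass of `a`.
  obtain ⟨c, -, hc⟩ : G.avg r a ∈ (fun c => G.avg r (clip c)) '' Icc (-‖S‖) (‖S‖ + 1) := by
    refine intermediate_value_Icc (by linarith [norm_nonneg S]) hcont.continuousOn ?_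
    have e0 : G.avg r 0 = 0 := by simp [avg, ip]
    have e1 : G.avg r 1 = 1 := div_self hK.ne'
    simp only [hlow, hhigh, e0, e1]
    exact G.avg_mem_Icc hV ha
  simp only at hc
  let b := clip c
  -- Up to scaling, the multiplier is the amount removed by truncation: zero where `clip` is
  -- inactive, of the required sign where it is active.
  let β : V → ℝ := lam⁻¹ • ((1 - lam) • b - S - c • (1 : V → ℝ))
  have hβ : lam • β = (1 - lam) • b - S - c • (1 : V → ℝ) := by
    simp only [β, smul_smul, mul_inv_cancel₀ h0.ne', one_smul]
  have hmass : lam * G.avg r β = (1 - lam) * G.avg r a - G.avg r a - c := by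
    have h : lam * G.ip r β 1 = (1 - lam) * G.ip r b 1 - G.ip r a 1 - c * G.ip r 1 1 := by
      rw [← ip_smul_left, hβ, ip_sub_left, ip_sub_left, ip_smul_left, ip_smul_left, hS,
        G.ip_heat_one hV]
    rw [← G.avg_mul_ip_one_one hV β, ← G.avg_mul_ip_one_one hV b, ← G.avg_mul_ip_one_one hV a,
      show G.avg r b = G.avg r a from hc] at h
    exact mul_right_cancel₀ hK.ne' (by linarith)
  refine ⟨b, β, hclip c, fun i => ⟨hclip c i, fun hi => ?_, fun hi => ?_, fun hi => ?_⟩, ?_⟩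
  · refine mul_nonneg (inv_nonneg.2 h0.le) ?_
    have hle : (S i + c) / (1 - lam) ≤ 0 := by
      by_contra! hlt
      have : 0 < clip c i := lt_max_of_lt_right (lt_min one_pos hlt)
      exact this.ne' hi
    have := (div_le_iff₀ hl).1 hle
    simp only [Pi.sub_apply, Pi.smul_apply, smul_eq_mul, hi, Pi.one_apply]
    linarith
  · have hmin : 0 < min 1 ((S i + c) / (1 - lam)) := by
      by_contra! hle
      exact hi.1.ne' (max_eq_left hle)
    have hmax : b i = min 1 ((S i + c) / (1 - lam)) := max_eq_right hmin.le
    have hval : b i = (S i + c) / (1 - lam) := by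
      rw [hmax]
      refine min_eq_right (le_of_not_gt fun hgt => ?_)
      rw [min_eq_left hgt.le] at hmax
      exact hi.2.ne hmax
    rw [eq_div_iff hl.ne'] at hval
    simp only [β, Pi.sub_apply, Pi.smul_apply, smul_eq_mul, Pi.one_apply]
    rw [show (1 - lam) * b i - S i - c * 1 = 0 by linarith, mul_zero]
  · refine mul_nonpos_of_nonneg_of_nonpos (inv_nonneg.2 h0.le) ?_
    have hle : 1 ≤ (S i + c) / (1 - lam) := by
      by_contra! hlt
      have : clip c i < 1 := max_lt one_pos (min_lt_of_right_lt hlt)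
      exact this.ne hi
    have := (le_div_iff₀ hl).1 hle
    simp only [Pi.sub_apply, Pi.smul_apply, smul_eq_mul, hi, Pi.one_apply]
    linarith
  · rw [hβ, hmass, show G.avg r b = G.avg r a from hc, diffusion_eq_heat, ← hS]
    module

theorem exists_isSemiDiscrete {r ε τ : ℝ} (hV : Nontrivial V ∨ r = 0) (hτ : 0 < τ) (hτε : τ < ε)
    {u₀ : V → ℝ} (hu₀ : ∀ i, u₀ i ∈ Icc (0 : ℝ) 1) :
    ∃ u β : ℕ → V → ℝ, G.IsSemiDiscrete r ε τ u₀ u β := by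
  have hε := hτ.trans hτε
  have key (a : {a : V → ℝ // ∀ i, a i ∈ Icc (0 : ℝ) 1}) :=
    G.exists_semiDiscrete_step hV τ (div_pos hτ hε) ((div_lt_one hε).2 hτε) a.2
  choose next β hnext hβ heq using key
  let u : ℕ → {a : V → ℝ // ∀ i, a i ∈ Icc (0 : ℝ) 1} := fun m =>
    (fun a => ⟨next a, hnext a⟩)^[m] ⟨u₀, hu₀⟩
  have hu (m : ℕ) : (u (m + 1) : V → ℝ) = next (u m) := by
    simp only [u, Function.iterate_succ_apply']
  -- The multiplier of the step from `u m` to `u (m + 1)` carries the index `m + 1`, hence the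
  -- shift; the value at `0` is arbitrary.
  refine ⟨fun m => u m, fun m => β (u (m - 1)), rfl, fun m => ?_⟩
  simp only [hu, Nat.add_sub_cancel]
  exact ⟨hβ _, heq _⟩

theorem IsSemiDiscrete.mem_Icc {G : WeightedGraph V} {r ε τ : ℝ} {u₀ : V → ℝ} {u β : ℕ → V → ℝ}
    (h : G.IsSemiDiscrete r ε τ u₀ u β) (hu₀ : ∀ i, u₀ i ∈ Icc (0 : ℝ) 1) (m : ℕ) (i : V) :
    u m i ∈ Icc (0 : ℝ) 1 := by
  cases m with
  | zero => rw [h.1]; exact hu₀ i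
  | succ m => exact ((h.2 m).1 i).1

/-! ### Dissipation of the discrete energy. -/

/-- The rescaled Lyapunov functional of the semi-discrete scheme with time step `τ`. -/
noncomputable def discreteEnergy (r ε τ : ℝ) (u : V → ℝ) : ℝ :=
  1 / 2 * G.ip r u ((τ⁻¹ • (1 - G.heat r τ)) u) + 1 / (2 * ε) * G.ip r u (1 - u)

theorem two_mul_mul_discreteEnergy (r ε : ℝ) {τ : ℝ} (hτ : τ ≠ 0) (u : V → ℝ) :
    2 * τ * G.discreteEnergy r ε τ u =
      G.ip r u u - G.ip r u (G.heat r τ u) + τ / ε * (G.ip r u 1 - G.ip r u u) := by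
  simp only [discreteEnergy, smul_apply, ip_smul_right, sub_apply, ip_sub_right,
    one_apply_eq_self]
  field_simp

/-- With `S = e^(-τΔ)`, the right side minus the left is `⟨b - a, S (b - a)⟩ - 2λ⟨b - a, β⟩`, and
both terms are nonnegative. -/
theorem discreteEnergy_step {r ε τ : ℝ} (hV : Nontrivial V ∨ r = 0) (hτ : 0 < τ) (hτε : τ < ε)
    {a b β : V → ℝ} (ha : ∀ i, a i ∈ Icc (0 : ℝ) 1) (hβ : β ∈ negSubdiff b)
    (heq : b - G.diffusion r τ a - (τ / ε) • b + (τ / ε * G.avg r b) • (1 : V → ℝ)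
      = (τ / ε) • β - (τ / ε * G.avg r β) • (1 : V → ℝ)) :
    (1 - τ / ε) * G.ip r (b - a) (b - a) ≤
      2 * τ * (G.discreteEnergy r ε τ a - G.discreteEnergy r ε τ b) := by
  have hlam : 0 < τ / ε := div_pos hτ (hτ.trans hτε)
  rw [diffusion_eq_heat] at heq
  have htest (w : V → ℝ) := congrArg (G.ip r w) heq
  simp only [ip_add_right, ip_sub_right, ip_smul_right] at htest
  have hmass : G.ip r b 1 = G.ip r a 1 := by
    -- Testing with the constant `1` cancels both averages and leaves conservation of mass.
    have h := htest 1
    rw [G.ip_comm r 1 b, G.ip_comm r 1 β, G.ip_comm r 1 (G.heat r τ a), G.ip_heat_one hV,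
      mul_assoc, mul_assoc, G.avg_mul_ip_one_one hV, G.avg_mul_ip_one_one hV] at h
    linarith
  have hsign : G.ip r (b - a) β ≤ 0 := Finset.sum_nonpos fun i _ =>
    mul_nonpos_of_nonpos_of_nonneg (sub_mul_nonpos_of_mem_negSubdiff ha hβ i)
      (G.degree_rpow_pos hV i).le
  have hpsd := G.ip_heat_nonneg hV τ (b - a)
  have h := htest (b - a)
  have hsign' := mul_nonpos_of_nonneg_of_nonpos hlam.le hsign
  rw [mul_sub, G.two_mul_mul_discreteEnergy r ε hτ.ne', G.two_mul_mul_discreteEnergy r ε hτ.ne']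
  simp only [map_sub, ip_sub_left, ip_sub_right, hmass, sub_self, mul_zero] at h hpsd hsign' ⊢
  have hc : G.ip r a (G.heat r τ b) = G.ip r b (G.heat r τ a) := by
    rw [← G.ip_heat_comm hV, G.ip_comm]
  rw [G.ip_comm r a b] at *
  linarith

theorem IsSemiDiscrete.ip_self_sub_le {G : WeightedGraph V} {r ε τ : ℝ} {u₀ : V → ℝ}
    {u β : ℕ → V → ℝ} (h : G.IsSemiDiscrete r ε τ u₀ u β) (hV : Nontrivial V ∨ r = 0)
    (hτ : 0 < τ) (hτε : τ < ε) (hu₀ : ∀ i, u₀ i ∈ Icc (0 : ℝ) 1) {m k : ℕ} (hmk : m ≤ k) :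
    (1 - τ / ε) * G.ip r (u k - u m) (u k - u m) ≤
      2 * (k * τ - m * τ) * (G.discreteEnergy r ε τ (u m) - G.discreteEnergy r ε τ (u k)) := by
  obtain ⟨k, rfl⟩ := Nat.exists_eq_add_of_le hmk
  have hl : 0 ≤ 1 - τ / ε := sub_nonneg.2 ((div_lt_one (hτ.trans hτε)).2 hτε).le
  have hsum : (1 - τ / ε) * ∑ j ∈ Finset.range k,
      G.ip r (u (m + j + 1) - u (m + j)) (u (m + j + 1) - u (m + j)) ≤
        2 * τ * (G.discreteEnergy r ε τ (u m) - G.discreteEnergy r ε τ (u (m + k))) := by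
    have htel := Finset.sum_range_sub' (fun j => G.discreteEnergy r ε τ (u (m + j))) k
    rw [add_zero] at htel
    rw [← htel, Finset.mul_sum, Finset.mul_sum]
    exact Finset.sum_le_sum fun j _ => G.discreteEnergy_step hV hτ hτε (h.mem_Icc hu₀ _)
      (h.2 (m + j)).1 (h.2 (m + j)).2
  calc _ ≤ (1 - τ / ε) * (k * ∑ j ∈ Finset.range k,
        G.ip r (u (m + j + 1) - u (m + j)) (u (m + j + 1) - u (m + j))) :=
        mul_le_mul_of_nonneg_left (G.ip_self_sub_le r u m k) hl
    _ ≤ k * (2 * τ * (G.discreteEnergy r ε τ (u m) - G.discreteEnergy r ε τ (u (m + k)))) := by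
        rw [mul_left_comm]
        exact mul_le_mul_of_nonneg_left hsum k.cast_nonneg
    _ = _ := by
        push_cast
        ring

end WeightedGraph

/-! ### Compactness of approximately Hölder functions. -/

/-- A compactness principle of Arzelà–Ascoli type for functions on `[0, ∞)` that satisfy a uniform
`1/2`-Hölder bound up to a vanishing error. -/
theorem exists_subseq_tendsto_of_sq_sub_le {V : Type*} [Fintype V] {f : ℕ → ℝ → V → ℝ}
    {C : V → ℝ} {δ : ℕ → ℝ} (hf : ∀ n t i, f n t i ∈ Icc (0 : ℝ) 1) (hC : ∀ i, 0 ≤ C i)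
    (hδ : Tendsto δ atTop (𝓝 0))
    (hle : ∀ n i s t, 0 ≤ s → s ≤ t → (f n t i - f n s i) ^ 2 ≤ C i * (t - s + δ n)) :
    ∃ φ : ℕ → ℕ, StrictMono φ ∧ ∃ g : ℝ → V → ℝ,
      ∀ t, 0 ≤ t → Tendsto (fun n => f (φ n) t) atTop (𝓝 (g t)) := by
  have hcomp : IsCompact (univ.pi fun _ : ℚ => univ.pi fun _ : V => Icc (0 : ℝ) 1) :=
    isCompact_univ_pi fun _ => isCompact_univ_pi fun _ => isCompact_Icc
  -- Sequential compactness of the countable product replaces a diagonal argument over rational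
  -- times.
  obtain ⟨ℓ, -, φ, hφ, hℓ⟩ := hcomp.tendsto_subseq (x := fun n (q : ℚ) => f n q)
    fun n q _ i _ => hf n q i
  have hδφ := hδ.comp hφ.tendsto_atTop
  have hcauchy (t : ℝ) (ht : 0 ≤ t) (i : V) : CauchySeq fun n => f (φ n) t i := by
    refine Metric.cauchySeq_iff.2 fun η hη => ?_
    have hC1 : 0 < C i + 1 := by linarith [hC i]
    -- Both `q - t` and `δ` will be below `ρ`; `C i + 1` guards against `C i = 0`.
    let ρ := (η / 4) ^ 2 / (2 * (C i + 1))
    have hρ : 0 < ρ := by positivity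
    have hρeq : (C i + 1) * (2 * ρ) = (η / 4) ^ 2 := by
      simp only [ρ]
      field_simp
    obtain ⟨q, hq1, hq2⟩ := exists_rat_btwn (lt_add_of_pos_right t hρ)
    have hlim : Tendsto (fun n => f (φ n) q i) atTop (𝓝 (ℓ q i)) :=
      tendsto_pi_nhds.1 (tendsto_pi_nhds.1 hℓ q) i
    obtain ⟨N, hN⟩ := eventually_atTop.1
      ((hδφ.eventually_lt_const hρ).and (Metric.tendsto_nhds.1 hlim (η / 4) (by positivity)))
    have hclose (n : ℕ) (hn : N ≤ n) : |f (φ n) t i - ℓ q i| < η / 2 := by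
      obtain ⟨h1, h2⟩ := hN n hn
      rw [Real.dist_eq] at h2
      have h1' : δ (φ n) < ρ := h1
      have h3 : (f (φ n) q i - f (φ n) t i) ^ 2 < (η / 4) ^ 2 := by
        calc _ ≤ C i * (q - t + δ (φ n)) := hle (φ n) i t q ht hq1.le
          _ ≤ C i * (2 * ρ) := mul_le_mul_of_nonneg_left (by linarith) (hC i)
          _ < (C i + 1) * (2 * ρ) := by nlinarith
          _ = _ := hρeq
      have h4 := abs_lt_of_sq_lt_sq h3 (by positivity)
      rw [abs_lt] at *
      constructor <;> linarith
    refine ⟨N, fun m hm n hn => ?_⟩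
    have h1 := hclose m hm
    have h2 := hclose n hn
    rw [Real.dist_eq]
    rw [abs_lt] at *
    constructor <;> linarith
  have hlim (t : ℝ) (i : V) : ∃ x, 0 ≤ t → Tendsto (fun n => f (φ n) t i) atTop (𝓝 x) := by
    by_cases ht : 0 ≤ t
    · obtain ⟨x, hx⟩ := cauchySeq_tendsto_of_complete (hcauchy t ht i)
      exact ⟨x, fun _ => hx⟩
    · exact ⟨0, fun h => absurd h ht⟩
  choose g hg using hlim
  exact ⟨φ, hφ, g, fun t ht => tendsto_pi_nhds.2 fun i => hg t i ht⟩

theorem tendsto_natCeil_div_mul {τ : ℕ → ℝ} (hpos : ∀ n, 0 < τ n) (hτ : Tendsto τ atTop (𝓝 0))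
    {t : ℝ} (ht : 0 ≤ t) : Tendsto (fun n => (⌈t / τ n⌉₊ : ℝ) * τ n) atTop (𝓝 t) := by
  have h : Tendsto (fun n => (τ n)⁻¹) atTop atTop := tendsto_inv_nhdsGT_zero.comp
    (tendsto_nhdsWithin_iff.2 ⟨hτ, Eventually.of_forall hpos⟩)
  simpa [Function.comp_def, div_eq_mul_inv] using (tendsto_nat_ceil_mul_div_atTop ht).comp h

theorem EReal.coe_sum {ι : Type*} (s : Finset ι) (f : ι → ℝ) :
    ((∑ i ∈ s, f i : ℝ) : EReal) = ∑ i ∈ s, (f i : EReal) :=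
  map_sum (⟨⟨Real.toEReal, EReal.coe_zero⟩, EReal.coe_add⟩ : ℝ →+ EReal) f s

/-! ### Passage to the limit `τ → 0`. -/

namespace WeightedGraph

variable {V : Type*} [Fintype V] (G : WeightedGraph V)

/-- The Ginzburg–Landau energy of a state with values in `[0, 1]`, as a real number. -/
noncomputable def obstacleEnergy (r ε : ℝ) (u : V → ℝ) : ℝ :=
  1 / 2 * G.ip r u (G.laplacian r u) + 1 / (2 * ε) * G.ip r u (1 - u)

theorem ginzburgLandau_eq_obstacleEnergy {r : ℝ} (hV : Nontrivial V ∨ r = 0) (ε : ℝ) {u : V → ℝ}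
    (hu : ∀ i, u i ∈ Icc (0 : ℝ) 1) :
    G.ginzburgLandau r ε u = (G.obstacleEnergy r ε u : EReal) := by
  have hsum : ∑ i, doubleObstacle (u i) * ((G.degree i ^ r : ℝ) : EReal) =
      ((1 / 2 * G.ip r u (1 - u) : ℝ) : EReal) := by
    rw [ip, Finset.mul_sum, EReal.coe_sum]
    refine Finset.sum_congr rfl fun i _ => ?_
    rw [doubleObstacle, if_pos ⟨(hu i).1, (hu i).2⟩, ← EReal.coe_mul, EReal.coe_eq_coe_iff]
    simp only [Pi.sub_apply, Pi.one_apply]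
    ring
  rw [ginzburgLandau, hsum, G.edgeNorm_grad_sq hV, ← EReal.coe_mul, ← EReal.coe_add,
    EReal.coe_eq_coe_iff, obstacleEnergy]
  ring

theorem tendsto_discreteEnergy (r ε : ℝ) {τ : ℕ → ℝ} (hpos : ∀ n, 0 < τ n)
    (hτ : Tendsto τ atTop (𝓝 0)) {w : ℕ → V → ℝ} {x : V → ℝ} (hw : Tendsto w atTop (𝓝 x)) :
    Tendsto (fun n => G.discreteEnergy r ε (τ n) (w n)) atTop (𝓝 (G.obstacleEnergy r ε x)) := by
  have h1 : Tendsto (fun n => ((τ n)⁻¹ • (1 - G.heat r (τ n))) (w n)) atTop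
      (𝓝 (G.laplacian r x)) :=
    (isBoundedBilinearMap_apply.continuous.tendsto (_, x)).comp
      ((G.tendsto_inv_smul_one_sub_heat r hpos hτ).prodMk_nhds hw)
  have h2 := ((G.continuous_ip r).tendsto (x, G.laplacian r x)).comp (hw.prodMk_nhds h1)
  have h3 := ((G.continuous_ip r).tendsto (x, 1 - x)).comp (hw.prodMk_nhds (hw.const_sub 1))
  exact (h2.const_mul _).add (h3.const_mul _)

theorem abs_ip_le (r : ℝ) (u v : V → ℝ) :
    |G.ip r u v| ≤ (∑ i, G.degree i ^ r) * (‖u‖ * ‖v‖) := by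
  rw [ip, Finset.sum_mul]
  refine (Finset.abs_sum_le_sum_abs _ _).trans (Finset.sum_le_sum fun i _ => ?_)
  have hd := Real.rpow_nonneg (G.degree_nonneg i) r
  rw [abs_mul, abs_mul, abs_of_nonneg hd, mul_comm]
  exact mul_le_mul_of_nonneg_left (mul_le_mul (norm_le_pi_norm u i) (norm_le_pi_norm v i)
    (abs_nonneg _) (norm_nonneg u)) hd

/-- The difference quotients of the semigroup converge, so their operator norms are bounded
uniformly in `n`. -/
theorem exists_abs_discreteEnergy_le (r : ℝ) {ε : ℝ} (hε : 0 < ε) {τ : ℕ → ℝ}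
    (hpos : ∀ n, 0 < τ n) (hτ : Tendsto τ atTop (𝓝 0)) :
    ∃ B, ∀ n (u : V → ℝ), (∀ i, u i ∈ Icc (0 : ℝ) 1) → |G.discreteEnergy r ε (τ n) u| ≤ B := by
  obtain ⟨M, hM⟩ := (G.tendsto_inv_smul_one_sub_heat r hpos hτ).norm.bddAbove_range
  have hK : 0 ≤ ∑ i, G.degree i ^ r :=
    Finset.sum_nonneg fun i _ => Real.rpow_nonneg (G.degree_nonneg i) r
  refine ⟨1 / 2 * ((∑ i, G.degree i ^ r) * (1 * M)) +
    1 / (2 * ε) * ((∑ i, G.degree i ^ r) * (1 * 1)), fun n u hu => ?_⟩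
  have hu1 : ‖u‖ ≤ 1 := (pi_norm_le_iff_of_nonneg zero_le_one).2 fun i =>
    abs_le.2 ⟨by linarith [(hu i).1], (hu i).2⟩
  have hu2 : ‖1 - u‖ ≤ 1 := (pi_norm_le_iff_of_nonneg zero_le_one).2 fun i =>
    abs_le.2 ⟨by simp only [Pi.sub_apply, Pi.one_apply]; linarith [(hu i).2],
      by simp only [Pi.sub_apply, Pi.one_apply]; linarith [(hu i).1]⟩
  have hD : ‖((τ n)⁻¹ • (1 - G.heat r (τ n))) u‖ ≤ M := by
    have hMn := hM (mem_range_self n)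
    refine (ContinuousLinearMap.le_opNorm _ u).trans ?_
    exact (mul_le_of_le_one_right (norm_nonneg _) hu1).trans hMn
  refine (abs_add_le _ _).trans (add_le_add ?_ ?_)
  · rw [abs_mul, abs_of_pos (by norm_num : (0 : ℝ) < 1 / 2)]
    refine mul_le_mul_of_nonneg_left ((G.abs_ip_le r _ _).trans ?_) (by norm_num)
    exact mul_le_mul_of_nonneg_left (mul_le_mul hu1 hD (norm_nonneg _) zero_le_one) hK
  · rw [abs_mul, abs_of_pos (by positivity : 0 < 1 / (2 * ε))]
    refine mul_le_mul_of_nonneg_left ((G.abs_ip_le r _ _).trans ?_) (by positivity)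
    exact mul_le_mul_of_nonneg_left (mul_le_mul hu1 hu2 (norm_nonneg _) zero_le_one) hK

theorem exists_semiDiscreteLimit {r : ℝ} (hV : Nontrivial V ∨ r = 0) {ε : ℝ} (hε : 0 < ε)
    {u₀ : V → ℝ} (hu₀ : ∀ i, u₀ i ∈ Icc (0 : ℝ) 1) {τ : ℕ → ℝ} (hpos : ∀ n, 0 < τ n)
    (hsmall : ∀ n, τ n < ε / 2) (hτ : Tendsto τ atTop (𝓝 0)) :
    ∃ φ : ℕ → ℕ, StrictMono φ ∧ ∃ û : ℝ → V → ℝ,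
      G.IsSemiDiscreteLimit r ε u₀ (τ ∘ φ) û := by
  have hlt (n : ℕ) : τ n < ε := (hsmall n).trans (half_lt_self hε)
  choose u β hu using fun n => G.exists_isSemiDiscrete hV (hpos n) (hlt n) hu₀
  obtain ⟨B, hB⟩ := G.exists_abs_discreteEnergy_le r hε hpos hτ
  have hB0 : 0 ≤ B := (abs_nonneg _).trans (hB 0 u₀ hu₀)
  have hC (i : V) : 0 ≤ 8 * B / G.degree i ^ r :=
    div_nonneg (by positivity) (G.degree_rpow_pos hV i).le
  -- The constant `8 * B` combines `1 - λ ≥ 1/2`, the factor `2` of the dissipation estimate, and an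
  -- energy drop of at most `2 * B`.
  have hstep (n : ℕ) (i : V) {m k : ℕ} (hmk : m ≤ k) :
      (u n k i - u n m i) ^ 2 ≤ 8 * B / G.degree i ^ r * (k * τ n - m * τ n) := by
    have hd := G.degree_rpow_pos hV i
    have h := (hu n).ip_self_sub_le hV (hpos n) (hlt n) hu₀ hmk
    have hlam : 1 / 2 ≤ 1 - τ n / ε := by
      have : τ n / ε ≤ 1 / 2 := (div_le_iff₀ hε).2 (by linarith [hsmall n])
      linarith
    have h1 := mul_le_mul_of_nonneg_right hlam (G.ip_self_nonneg r (u n k - u n m))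
    have h2 := G.sq_mul_le_ip_self r (u n k - u n m) i
    have h3 : G.discreteEnergy r ε (τ n) (u n m) - G.discreteEnergy r ε (τ n) (u n k) ≤ 2 * B := by
      have hm := abs_le.1 (hB n (u n m) ((hu n).mem_Icc hu₀ m))
      have hk := abs_le.1 (hB n (u n k) ((hu n).mem_Icc hu₀ k))
      linarith [hm.2, hk.1]
    have hT : 0 ≤ 2 * (k * τ n - m * τ n) := by
      have : (m : ℝ) * τ n ≤ k * τ n :=
        mul_le_mul_of_nonneg_right (by exact_mod_cast hmk) (hpos n).le
      linarith
    have h4 := mul_le_mul_of_nonneg_left h3 hT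
    rw [div_mul_eq_mul_div, le_div_iff₀ hd]
    rw [Pi.sub_apply] at h2
    linarith
  obtain ⟨φ, hφ, û, hû⟩ := exists_subseq_tendsto_of_sq_sub_le
    (f := fun n t => u n ⌈t / τ n⌉₊) (fun n t i => (hu n).mem_Icc hu₀ _ i) hC hτ
    fun n i s t hs hst => by
      -- Rounding both times up to the grid lengthens the interval by at most one time step, so `τ`
      -- itself is the vanishing error.
      refine (hstep n i (Nat.ceil_mono (div_le_div_of_nonneg_right hst (hpos n).le))).trans
        (mul_le_mul_of_nonneg_left ?_ (hC i))
      have ht := mul_le_mul_of_nonneg_right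
        (Nat.ceil_lt_add_one (div_nonneg (hs.trans hst) (hpos n).le)).le (hpos n).le
      have hs' := mul_le_mul_of_nonneg_right (Nat.le_ceil (s / τ n)) (hpos n).le
      rw [add_mul, one_mul, div_mul_cancel₀ _ (hpos n).ne'] at ht
      rw [div_mul_cancel₀ _ (hpos n).ne'] at hs'
      linarith
  exact ⟨φ, hφ, û, fun n => ⟨hpos _, hlt _⟩, hτ.comp hφ.tendsto_atTop,
    fun n => u (φ n), fun n => β (φ n), fun n => hu (φ n), hû⟩

theorem IsSemiDiscreteLimit.mem_Icc {G : WeightedGraph V} {r ε : ℝ} {u₀ : V → ℝ} {τ : ℕ → ℝ}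
    {û : ℝ → V → ℝ} (h : G.IsSemiDiscreteLimit r ε u₀ τ û) (hu₀ : ∀ i, u₀ i ∈ Icc (0 : ℝ) 1)
    {t : ℝ} (ht : 0 ≤ t) (i : V) : û t i ∈ Icc (0 : ℝ) 1 := by
  obtain ⟨-, -, u, β, hu, hlim⟩ := h
  exact isClosed_Icc.mem_of_tendsto (tendsto_pi_nhds.1 (hlim t ht) i)
    (Eventually.of_forall fun n => (hu n).mem_Icc hu₀ _ i)

theorem IsSemiDiscreteLimit.ip_self_sub_le {G : WeightedGraph V} {r ε : ℝ} {u₀ : V → ℝ}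
    {τ : ℕ → ℝ} {û : ℝ → V → ℝ} (h : G.IsSemiDiscreteLimit r ε u₀ τ û)
    (hV : Nontrivial V ∨ r = 0) (hu₀ : ∀ i, u₀ i ∈ Icc (0 : ℝ) 1)
    {s t : ℝ} (hs : 0 ≤ s) (hst : s ≤ t) :
    G.ip r (û s - û t) (û s - û t) ≤
      2 * (t - s) * (G.obstacleEnergy r ε (û s) - G.obstacleEnergy r ε (û t)) := by
  obtain ⟨hτ, hτ0, u, β, hu, hlim⟩ := h
  have hpos (n : ℕ) := (hτ n).1
  have ht := hs.trans hst
  have hl : Tendsto (fun n => 1 - τ n / ε) atTop (𝓝 1) := by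
    simpa using (hτ0.div_const ε).const_sub 1
  have hd := (hlim t ht).sub (hlim s hs)
  have hL := hl.mul (((G.continuous_ip r).tendsto (û t - û s, û t - û s)).comp (hd.prodMk_nhds hd))
  have hR := (((tendsto_natCeil_div_mul hpos hτ0 ht).sub
    (tendsto_natCeil_div_mul hpos hτ0 hs)).const_mul 2).mul
      ((G.tendsto_discreteEnergy r ε hpos hτ0 (hlim s hs)).sub
        (G.tendsto_discreteEnergy r ε hpos hτ0 (hlim t ht)))
  have key := le_of_tendsto_of_tendsto' hL hR fun n => (hu n).ip_self_sub_le hV (hpos n) (hτ n).2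
    hu₀ (Nat.ceil_mono (div_le_div_of_nonneg_right hst (hpos n).le))
  rw [one_mul] at key
  rwa [← neg_sub (û t), ← neg_one_smul ℝ (û t - û s), ip_smul_left, ip_smul_right, neg_one_mul,
    neg_one_mul, neg_neg]

end WeightedGraph

theorem mainTheorem11 {V : Type*} [Fintype V] (G : WeightedGraph V)
    (r : ℝ) (hr : r ∈ Icc (0 : ℝ) 1) (hV : Nontrivial V ∨ r = 0)
    (ε : ℝ) (hε : 0 < ε) (u₀ : V → ℝ) (hu₀ : ∀ i, u₀ i ∈ Icc (0 : ℝ) 1) :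
    (∀ τ : ℕ → ℝ, (∀ n, 0 < τ n) → Tendsto τ atTop (𝓝 0) →
      ∃ φ : ℕ → ℕ, StrictMono φ ∧ ∃ û : ℝ → V → ℝ,
        G.IsSemiDiscreteLimit r ε u₀ (τ ∘ φ) û) ∧
    ∀ (τ : ℕ → ℝ) (û : ℝ → V → ℝ), G.IsSemiDiscreteLimit r ε u₀ τ û →
      AntitoneOn (fun t => G.ginzburgLandau r ε (û t)) (Ici 0) ∧
      ∀ s t : ℝ, 0 ≤ s → s < t →
        G.ginzburgLandau r ε (û s) - G.ginzburgLandau r ε (û t) ≥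
          ((1 / (2 * (t - s)) * G.vnorm r (û s - û t) ^ 2 : ℝ) : EReal) := by
  refine ⟨fun τ hpos hτ => ?_, fun τ û h => ?_⟩
  -- Dropping finitely many time steps puts the rest below `ε / 2`, which keeps `1 - λ` away from
  -- `0`.
  · obtain ⟨N, hN⟩ := eventually_atTop.1 (hτ.eventually_lt_const (half_pos hε))
    obtain ⟨φ, hφ, û, hû⟩ := G.exists_semiDiscreteLimit hV hε hu₀ (τ := fun n => τ (n + N))
      (fun n => hpos _) (fun n => hN _ (Nat.le_add_left N n)) ((tendsto_add_atTop_iff_nat N).2 hτ)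
    exact ⟨fun n => φ n + N, fun a b hab => Nat.add_lt_add_right (hφ hab) N, û, hû⟩
  · have hGL {t : ℝ} (ht : 0 ≤ t) := G.ginzburgLandau_eq_obstacleEnergy hV ε (h.mem_Icc hu₀ ht)
    have key {s t : ℝ} (hs : 0 ≤ s) (hst : s < t) :
        1 / (2 * (t - s)) * G.vnorm r (û s - û t) ^ 2 ≤
          G.obstacleEnergy r ε (û s) - G.obstacleEnergy r ε (û t) := by
      have hpos : 0 < 2 * (t - s) := by linarith
      rw [G.vnorm_sq, one_div_mul_eq_div, div_le_iff₀' hpos]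
      exact h.ip_self_sub_le hV hu₀ hs hst.le
    refine ⟨fun s hs t ht hst => ?_, fun s t hs hst => ?_⟩
    · rcases hst.eq_or_lt with rfl | hlt
      · exact le_rfl
      · simp only [hGL hs, hGL ht, EReal.coe_le_coe_iff]
        have hpos : 0 < 2 * (t - s) := by linarith
        have : 0 ≤ 1 / (2 * (t - s)) * G.vnorm r (û s - û t) ^ 2 := by positivity
        linarith [key hs hlt]
    · rw [hGL hs, hGL (hs.trans hst.le), ← EReal.coe_sub, ge_iff_le, EReal.coe_le_coe_iff]
      exact key hs hst
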